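/- Definitions. All filters are on $\omega$. For ultrafilters $u,v$ on $\omega$ write $v\le_{RK}u$ if there is $f:\omega\to\omega$ with $f(u)=v$, where $f(u)=\{A\subset\omega : f^{-1}[A]\in u\}$, and $v<_{RK}u$ (equivalently $u>_{RK}v$) if $v\le_{RK}u$ but not $u\le_{RK}v$. The bounding number $\mathfrak b$ is the least cardinality of a family of functions $\omega\to\omega$ that is unbounded with respect to eventual domination, and $\mathfrak c=2^{\aleph_0}$. A sequential cascade is a tree $V$ with a least element, without infinite branches, in which every non-maximal element $v$ has a countably infinite set $v^+$ of immediate successors; its set $\max V$ of maximal elements is taken to be a subset of $\omega$. The rank is defined by $r(v)=0$ for $v\in\max V$, and otherwise $r(v)$ is the least ordinal greater than the ranks of all elements of $v^+$; $r(V)$ is the rank of the least element of $V$. The cascade is monotone if each $v^+$ can be enumerated in type $\omega$ with non-decreasing ranks. The contour $\int V$ is defined by recursion: for a one-point cascade it is the principal ultrafilter of that point; otherwise, if $V_0,V_1,\dots$ are the subcascades above the immediate successors of the least element of $V$, then $A\in\int V$ if and only if $A\in\int V_n$ for all but finitely many $n$. A monotone sequential contour of rank $\beta\ge 1$ is a filter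 $\int V$, where $V$ is a monotone sequential cascade of rank $\beta$. For $1\le\alpha\le\omega_1$, $\mathcal P_\alpha$ is the class of ultrafilters $u$ on $\omega$ such that for each $\beta$ with $1\le\beta<\alpha$ there is a monotone sequential contour of rank $\beta$ contained in $u$, and there is no monotone sequential contour of rank $\alpha$ contained in $u$. Theorem. Assume $\mathfrak b=\mathfrak c$. Let $1<\xi\le\omega_1$ and let $(p_n)_{n<\omega}$ be a sequence of elements of $\mathcal P_\xi$ that is RK-increasing, i.e. $p_{n+1}>_{RK}p_n$ for every $n<\omega$. Then there exists $u\in\mathcal P_\xi$ such that $u>_{RK}p_n$ for every $n<\omega$. -/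

import Mathlib

open scoped Ordinal Cardinal

noncomputable section

namespace PHierarchy

/-- A sequential cascade whose maximal elements are labelled by natural numbers: a tree without
infinite branches in which every non-maximal element has a set of immediate successors enumerated
in type `ω`. `leaf x` is the one-point cascade whose only element is labelled `x`; `node c` has a
root whose `n`-th immediate successor is the root of `c n`. -/
inductive Cascade : Type
  | leaf (x : ℕ) : Cascade
  | node (c : ℕ → Cascade) : Cascade

namespace Cascade

/-- The set of labels of the maximal elements. -/
def maxSet : Cascade → Set ℕ
  | leaf x => {x}
  | node c => ⋃ n, (c n).maxSet

/-- Distinct maximal elements carry distinct labels, so that `max V` may be identified with the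
subset `V.maxSet` of `ω`. -/
def InjLabels : Cascade → Prop
  | leaf _ => True
  | node c => (∀ n, (c n).InjLabels) ∧ ∀ m n, m ≠ n → Disjoint (c m).maxSet (c n).maxSet

/-- The rank: `0` at maximal elements, otherwise the least ordinal greater than the ranks of all
immediate successors. -/
def rank : Cascade → Ordinal.{0}
  | leaf _ => 0
  | node c => ⨆ n, Order.succ (c n).rank

theorem rank_node_le_iff (c : ℕ → Cascade) (o : Ordinal.{0}) :
    (node c).rank ≤ o ↔ ∀ n, (c n).rank < o := by
  rw [rank, Ordinal.iSup_le_iff]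
  simp only [Order.succ_le_iff]

/-- The cascade is monotone: at each non-maximal element the sequence of ranks of its immediate
successors is non-decreasing. -/
def IsMonotone : Cascade → Prop
  | leaf _ => True
  | node c => (∀ n, (c n).IsMonotone) ∧ Monotone fun n => (c n).rank

/-- The contour. At `node c` it is the contour of the filters `(c n).contour` along the cofinite
filter, that is `⋃ P cofinite, ⋂ n ∈ P, (c n).contour`; a one-point cascade contributes the
principal filter of its point. It is regarded as a filter on `ω` (generated by the corresponding
filter on the set of maximal elements). -/
def contour : Cascade → Filter ℕ
  | leaf x => pure x
  | node c => Filter.bind Filter.cofinite fun n => (c n).contour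

end Cascade

/-- `F` is a monotone sequential contour (on `ω`) of rank `β`; contours have rank at least `1`. -/
def IsMonotoneSequentialContour (β : Ordinal.{0}) (F : Filter ℕ) : Prop :=
  1 ≤ β ∧ ∃ V : Cascade, V.InjLabels ∧ V.IsMonotone ∧ V.rank = β ∧ V.contour = F

/-- The class `𝒫_α` of the P-hierarchy. Recall that for Mathlib's order on filters
`(u : Filter ℕ) ≤ F` says that every member of `F` belongs to `u`. -/
def classP (α : Ordinal.{0}) : Set (Ultrafilter ℕ) :=
  {u | (∀ β, 1 ≤ β → β < α → ∃ F, IsMonotoneSequentialContour β F ∧ (u : Filter ℕ) ≤ F) ∧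
    ¬ ∃ F, IsMonotoneSequentialContour α F ∧ (u : Filter ℕ) ≤ F}

/-- The Rudin–Keisler order `v ≤_RK u`: some `f : ω → ω` maps `u` to `v`. -/
def RKLE (v u : Ultrafilter ℕ) : Prop := ∃ f : ℕ → ℕ, u.map f = v

/-- The strict Rudin–Keisler order `v <_RK u`. -/
def RKLT (v u : Ultrafilter ℕ) : Prop := RKLE v u ∧ ¬ RKLE u v

/-- The bounding number `𝔟`: the least cardinality of a family of functions `ω → ω` that is
unbounded for eventual domination. -/
def boundingNumber : Cardinal.{0} :=
  sInf {κ | ∃ 𝓕 : Set (ℕ → ℕ), Cardinal.mk 𝓕 = κ ∧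
    ¬ ∃ g : ℕ → ℕ, ∀ f ∈ 𝓕, ∀ᶠ n in Filter.atTop, f n ≤ g n}

end PHierarchy

end

/-!
Let `f n` map `p (n + 1)` to `p n`. The inverse limit of this system gives maps `g i : ℕ → ℕ` and
a decreasing sequence of filters `comap (g i) (p i) ⊓ 𝓟 (C i)`, with infimum `G`
(`exists_inverse_limit`). Every ultrafilter `u ≤ G` satisfies `g i (u) = p i`, hence is
Rudin–Keisler above all `p i`, and strictly so because the sequence increases strictly. It remains
to find such a `u` in `𝒫_ξ`.

*Small ranks.* Containing a monotone sequential contour of rank `β` passes from `f (u)` to `u`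
(`exists_contour_of_map_le`): make `f` surjective, and replace every node of rank `1` of the cascade
by a node whose successors are the points of the preimage of its labels. So `u` inherits contours
of all ranks below `ξ` from `p 0`.

*Rank `ξ`.* There are only `𝔠` cascades, so a recursion of length `𝔠` produces `u`, putting into `u`
for each contour of rank `ξ` the complement of one of its members
(`exists_ultrafilter_forall_exists_mem`). The recursion goes through because a proper filter `𝓕`
generated by `G` and fewer than `𝔠` sets contains no contour `∫V` of rank `ξ` (`not_le_contour`).
Such an `𝓕` is covered by fewer than `𝔠 = 𝔟` filters generated by `comap (g i) (p i)` and one set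
`s ∈ 𝓕`. The sets `V.thin h` form a base of `∫V` indexed by the functions `h` from the countable set
of nodes to `ℕ`, so a diagonal argument with `𝔟` yields one of these filters that contains all
`V.thin h` with `h` vanishing on a fixed finite set of nodes. Now choose a section `φ` of `g i`
with values in `s` that lie above successors of the root of index as large as possible. Then
`φ (p i)` contains `∫V` (`exists_map_le_contour`), and so `p i` itself contains a contour of rank
`ξ`, which contradicts `p i ∈ 𝒫_ξ`.
-/

namespace PHierarchy

open Filter Set

/-! ### Elementary properties of contours -/

namespace Cascade

theorem maxSet_nonempty (V : Cascade) : V.maxSet.Nonempty := by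
  induction V with
  | leaf x => exact ⟨x, rfl⟩
  | node c ih =>
    obtain ⟨x, hx⟩ := ih 0
    exact ⟨x, mem_iUnion.2 ⟨0, hx⟩⟩

theorem one_le_rank_node (c : ℕ → Cascade) : 1 ≤ (node c).rank := by
  have h := (rank_node_le_iff c _).1 le_rfl 0
  exact Order.one_le_iff_pos.2 (h.bot_lt)

theorem maxSet_infinite {c : ℕ → Cascade} (hV : (node c).InjLabels) :
    (node c).maxSet.Infinite := by
  choose x hx using fun n => (c n).maxSet_nonempty
  have hinj : Function.Injective x := by
    intro m n hmn
    by_contra hne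
    exact Set.disjoint_left.1 (hV.2 m n hne) (hx m) (hmn ▸ hx n)
  exact (Set.infinite_range_of_injective hinj).mono
    (range_subset_iff.2 fun n => mem_iUnion.2 ⟨n, hx n⟩)

theorem mem_contour_node {c : ℕ → Cascade} {A : Set ℕ} :
    A ∈ (node c).contour ↔ ∀ᶠ n in cofinite, A ∈ (c n).contour := by
  rw [contour, Filter.mem_bind']
  rfl

theorem maxSet_mem_contour (V : Cascade) : V.maxSet ∈ V.contour := by
  induction V with
  | leaf x => exact Filter.mem_pure.2 rfl
  | node c ih =>
    exact mem_contour_node.2 (Eventually.of_forall fun n =>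
      mem_of_superset (ih n) (subset_iUnion (fun n => (c n).maxSet) n))

theorem contour_le_cofinite {c : ℕ → Cascade} (hV : (node c).InjLabels) :
    (node c).contour ≤ cofinite := by
  refine le_cofinite_iff_compl_singleton_mem.2 fun x => mem_contour_node.2 ?_
  have hfin : {n | x ∈ (c n).maxSet}.Finite := by
    refine Set.Subsingleton.finite fun m hm n hn => ?_
    by_contra hne
    exact Set.disjoint_left.1 (hV.2 m n hne) hm hn
  filter_upwards [hfin.compl_mem_cofinite] with n hn
  exact mem_of_superset (c n).maxSet_mem_contour fun y hy hyx => hn (hyx ▸ hy)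

/-! ### Pulling a cascade back along a map -/

open Classical in
/-- The cascade whose nodes of rank `1` are replaced by nodes enumerating the preimage under `f`
of their set of labels, the nodes of higher rank being kept. The value at a leaf only has to
be a preimage of its label; it is given by `σ`, which is meant to be a right inverse of `f`. -/
noncomputable def pullback (f σ : ℕ → ℕ) : Cascade → Cascade
  | leaf x => leaf (σ x)
  | node c =>
    if (node c).rank = 1 then node fun k => leaf (Nat.nth (fun y => f y ∈ (node c).maxSet) k)
    else node fun n => (c n).pullback f σ

theorem rank_pullback (f σ : ℕ → ℕ) (V : Cascade) : (V.pullback f σ).rank = V.rank := by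
  induction V with
  | leaf x => rfl
  | node c ih =>
    rw [pullback]
    split_ifs with h
    · rw [h]
      refine le_antisymm ((rank_node_le_iff _ _).2 fun n => ?_) (one_le_rank_node _)
      exact zero_lt_one
    · simp only [rank, ih]

theorem infinite_preimage_maxSet {f : ℕ → ℕ} (hf : Function.Surjective f) {c : ℕ → Cascade}
    (hV : (node c).InjLabels) : {y | f y ∈ (node c).maxSet}.Infinite :=
  (maxSet_infinite hV).preimage (by rw [hf.range_eq]; exact subset_univ _)

theorem maxSet_pullback_subset {f σ : ℕ → ℕ} (hσ : Function.RightInverse σ f) {V : Cascade}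
    (hV : V.InjLabels) : (V.pullback f σ).maxSet ⊆ f ⁻¹' V.maxSet := by
  induction V with
  | leaf x => rintro _ rfl; exact hσ x
  | node c ih =>
    rw [pullback]
    split_ifs with h
    · refine iUnion_subset fun k => ?_
      rintro _ rfl
      exact Nat.nth_mem_of_infinite (infinite_preimage_maxSet hσ.surjective hV) k
    · exact iUnion_subset fun n => (ih n (hV.1 n)).trans
        (preimage_mono (subset_iUnion (fun n => (c n).maxSet) n))

theorem InjLabels.pullback {f σ : ℕ → ℕ} (hσ : Function.RightInverse σ f) {V : Cascade}
    (hV : V.InjLabels) : (V.pullback f σ).InjLabels := by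
  induction V with
  | leaf x => trivial
  | node c ih =>
    rw [Cascade.pullback]
    split_ifs with h
    · refine ⟨fun _ => trivial, fun m n hmn => Set.disjoint_singleton.2 fun he => hmn ?_⟩
      exact Nat.nth_injective (infinite_preimage_maxSet hσ.surjective hV) he
    · exact ⟨fun n => ih n (hV.1 n), fun m n hmn =>
        ((hV.2 m n hmn).preimage f).mono (maxSet_pullback_subset hσ (hV.1 m))
          (maxSet_pullback_subset hσ (hV.1 n))⟩

theorem IsMonotone.pullback (f σ : ℕ → ℕ) {V : Cascade} (hV : V.IsMonotone) :
    (V.pullback f σ).IsMonotone := by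
  induction V with
  | leaf x => trivial
  | node c ih =>
    rw [Cascade.pullback]
    split_ifs with h
    · exact ⟨fun _ => trivial, fun _ _ _ => le_rfl⟩
    · refine ⟨fun n => ih n (hV.1 n), ?_⟩
      simp only [rank_pullback]
      exact hV.2

/-- A leaf does not satisfy this: its pullback has the principal filter of a single point of the
fibre as contour. Hence the bound on the rank. -/
theorem comap_contour_le_pullback {f σ : ℕ → ℕ} (hf : Function.Surjective f) {V : Cascade}
    (hV : V.InjLabels) (hm : V.IsMonotone) (hr : 1 ≤ V.rank) :
    comap f V.contour ≤ (V.pullback f σ).contour := by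
  induction V with
  | leaf x => exact absurd hr (not_le.2 zero_lt_one)
  | node c ih =>
    intro S hS
    rw [pullback] at hS
    split_ifs at hS with h
    · have hinf := infinite_preimage_maxSet hf hV
      have hS' : {k | Nat.nth (fun y => f y ∈ (node c).maxSet) k ∉ S}.Finite :=
        mem_contour_node.1 hS
      -- Removing the finite image under `f` of the missed points keeps whole fibres inside `S`.
      refine mem_comap.2 ⟨(node c).maxSet \ ((fun k => f (Nat.nth (fun y => f y ∈
        (node c).maxSet) k)) '' {k | Nat.nth (fun y => f y ∈ (node c).maxSet) k ∉ S}),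
        inter_mem (maxSet_mem_contour _)
          (contour_le_cofinite hV (hS'.image _).compl_mem_cofinite), ?_⟩
      rintro y ⟨hy, hyn⟩
      by_contra hyS
      obtain ⟨k, rfl⟩ : y ∈ range (Nat.nth fun y => f y ∈ (node c).maxSet) := by
        rw [Nat.range_nth_of_infinite hinf]; exact hy
      exact hyn ⟨k, hyS, rfl⟩
    · obtain ⟨N, hN⟩ : ∃ N, 1 ≤ (c N).rank := by
        by_contra! hlt
        exact h (le_antisymm ((rank_node_le_iff c 1).2 hlt) hr)
      have hev : ∀ᶠ n in cofinite, 1 ≤ (c n).rank := by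
        rw [Nat.cofinite_eq_atTop]
        filter_upwards [eventually_ge_atTop N] with n hn
        exact hN.trans (hm.2 hn)
      refine mem_comap'.2 (mem_contour_node.2 ?_)
      filter_upwards [hev, mem_contour_node.1 hS] with n hn hSn
      exact mem_comap'.1 (ih n (hV.1 n) (hm.1 n) hn hSn)

/-! ### A base of a contour indexed by functions on the nodes -/

/-- The set of labels of the maximal elements reached from the root by steps that, at the node
with address `l`, only use the successors of index at least `h l`. -/
def thin : Cascade → (List ℕ → ℕ) → Set ℕ
  | leaf x => fun _ => {x}
  | node c => fun h => ⋃ n, ⋃ (_ : h [] ≤ n), (c n).thin fun l => h (n :: l)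

theorem mem_thin_node {c : ℕ → Cascade} {h : List ℕ → ℕ} {x : ℕ} :
    x ∈ (node c).thin h ↔ ∃ n, h [] ≤ n ∧ x ∈ (c n).thin fun l => h (n :: l) := by
  simp [thin]

theorem thin_subset_maxSet (V : Cascade) (h : List ℕ → ℕ) : V.thin h ⊆ V.maxSet := by
  induction V generalizing h with
  | leaf x => exact subset_rfl
  | node c ih =>
    intro x hx
    obtain ⟨n, -, hx⟩ := mem_thin_node.1 hx
    exact mem_iUnion.2 ⟨n, ih n _ hx⟩

theorem thin_anti (V : Cascade) {h h' : List ℕ → ℕ} (hh : h ≤ h') : V.thin h' ⊆ V.thin h := by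
  induction V generalizing h h' with
  | leaf x => exact subset_rfl
  | node c ih =>
    intro x hx
    obtain ⟨n, hn, hx⟩ := mem_thin_node.1 hx
    exact mem_thin_node.2 ⟨n, (hh []).trans hn, ih n (fun l => hh (n :: l)) hx⟩

theorem thin_mem_contour (V : Cascade) (h : List ℕ → ℕ) : V.thin h ∈ V.contour := by
  induction V generalizing h with
  | leaf x => exact Filter.mem_pure.2 rfl
  | node c ih =>
    refine mem_contour_node.2 ?_
    rw [Nat.cofinite_eq_atTop]
    filter_upwards [eventually_ge_atTop (h [])] with n hn
    exact mem_of_superset (ih n _) fun x hx => mem_thin_node.2 ⟨n, hn, hx⟩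

theorem exists_thin_subset {V : Cascade} {A : Set ℕ} (hA : A ∈ V.contour) :
    ∃ h, V.thin h ⊆ A := by
  induction V with
  | leaf x => exact ⟨0, singleton_subset_iff.2 (Filter.mem_pure.1 hA)⟩
  | node c ih =>
    rw [mem_contour_node, Nat.cofinite_eq_atTop, eventually_atTop] at hA
    obtain ⟨N, hN⟩ := hA
    have : ∀ n, ∃ h, N ≤ n → (c n).thin h ⊆ A := fun n => by
      by_cases hn : N ≤ n
      · obtain ⟨h, hh⟩ := ih n (hN n hn)
        exact ⟨h, fun _ => hh⟩
      · exact ⟨0, fun h => absurd h hn⟩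
    choose h hh using this
    refine ⟨fun l => match l with
      | [] => N
      | n :: l => h n l, fun x hx => ?_⟩
    obtain ⟨n, hn, hx⟩ := mem_thin_node.1 hx
    exact hh n hn hx

/-! ### The number of cascades -/

/-- The label reached by following an address, if a maximal element is met on the way. -/
def label : Cascade → List ℕ → Option ℕ
  | leaf x, _ => some x
  | node _, [] => none
  | node c, n :: l => (c n).label l

theorem label_injective : Function.Injective label := by
  intro V
  induction V with
  | leaf x =>
    rintro (y | d) h
    · have := congrFun h []
      simp only [label, Option.some.injEq] at this
      rw [this]
    · exact absurd (congrFun h []) (by simp [label])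
  | node c ih =>
    rintro (y | d) h
    · exact absurd (congrFun h []) (by simp [label])
    · congr 1
      funext n
      exact ih n (funext fun l => congrFun h (n :: l))

theorem mk_le_continuum : Cardinal.mk Cascade ≤ Cardinal.continuum := by
  refine (Cardinal.mk_le_of_injective label_injective).trans ?_
  simp

end Cascade

open Cascade

/-! ### Contours and ultrafilters -/

theorem exists_bound_of_lt_boundingNumber {J : Type} (hJ : Cardinal.mk J < boundingNumber)
    (H : J → ℕ → ℕ) : ∃ g : ℕ → ℕ, ∀ j, ∀ᶠ n in atTop, H j n ≤ g n := by
  by_contra hno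
  have hmem : Cardinal.mk (range H) ∈ {κ | ∃ 𝓕 : Set (ℕ → ℕ), Cardinal.mk 𝓕 = κ ∧
      ¬ ∃ g : ℕ → ℕ, ∀ f ∈ 𝓕, ∀ᶠ n in Filter.atTop, f n ≤ g n} :=
    ⟨range H, rfl, fun ⟨g, hg⟩ => hno ⟨g, fun j => hg _ (mem_range_self j)⟩⟩
  exact absurd ((csInf_le' hmem).trans Cardinal.mk_range_le) (not_le.2 hJ)

/-- Containing a monotone sequential contour of a given rank is inherited by ultrafilters above
in the Rudin–Keisler order. -/
theorem exists_contour_of_map_le {β : Ordinal.{0}} {u : Ultrafilter ℕ} {f : ℕ → ℕ}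
    {F : Filter ℕ} (hF : IsMonotoneSequentialContour β F) (hle : map f u ≤ F) :
    ∃ F', IsMonotoneSequentialContour β F' ∧ (u : Filter ℕ) ≤ F' := by
  obtain ⟨hβ, V, hV, hm, rfl, rfl⟩ := hF
  -- Changing `f` on the even or on the odd numbers makes it surjective.
  obtain ⟨f', hf', hff⟩ : ∃ f' : ℕ → ℕ, Function.Surjective f' ∧ f' =ᶠ[u] f := by
    by_cases he : {n | Even n} ∈ u
    · refine ⟨fun n => if Even n then f n else n / 2, fun n => ⟨2 * n + 1, ?_⟩, ?_⟩
      · have : ¬ Even (2 * n + 1) := by simp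
        simp only [this, if_false]; omega
      · filter_upwards [he] with n hn
        exact if_pos hn
    · refine ⟨fun n => if Even n then n / 2 else f n, fun n => ⟨2 * n, by simp⟩, ?_⟩
      filter_upwards [Ultrafilter.compl_mem_iff_notMem.2 he] with n hn
      exact if_neg hn
  obtain ⟨σ, hσ⟩ := hf'.hasRightInverse
  refine ⟨_, ⟨hβ, V.pullback f' σ, hV.pullback hσ, hm.pullback _ _, rank_pullback _ _ _, rfl⟩, ?_⟩
  refine le_trans (map_le_iff_le_comap.1 ?_) (comap_contour_le_pullback hf' hV hm hβ)
  rwa [Filter.map_congr hff]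

/-- Suppose that fewer than `𝔟` filters, each generated by the preimages under `g j` of the members
of an ultrafilter `q j` together with one further set `s j`, cover a filter `𝓕` finer than a contour.
Then one of the ultrafilters `q j` has an image finer than that contour. -/
theorem exists_map_le_contour {J : Type} (hJ : Cardinal.mk J < boundingNumber) {𝓕 : Filter ℕ}
    [NeBot 𝓕] (q : J → Ultrafilter ℕ) (hq : ∀ j, (q j : Filter ℕ) ≤ cofinite) (g : J → ℕ → ℕ)
    (hg : ∀ j, map (g j) 𝓕 ≤ q j) (s : J → Set ℕ) (hs : ∀ j, s j ∈ 𝓕)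
    (hcov : ∀ A ∈ 𝓕, ∃ j, A ∈ comap (g j) (q j) ⊓ 𝓟 (s j)) {c : ℕ → Cascade}
    (hinj : (node c).InjLabels) (hle : 𝓕 ≤ (node c).contour) :
    ∃ (j : J) (φ : ℕ → ℕ), map φ (q j) ≤ (node c).contour := by
  let e : List ℕ ≃ ℕ := Denumerable.eqv (List ℕ)
  -- One of the filters contains all the sets `thin h` with `h` null on a fixed finite set of nodes.
  obtain ⟨j, n, hjn⟩ : ∃ (j : J) (n : ℕ), ∀ h : List ℕ → ℕ, (∀ l, e l < n → h l = 0) →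
      (node c).thin h ∈ comap (g j) (q j) ⊓ 𝓟 (s j) := by
    by_contra! hno
    choose h hz hnot using hno
    obtain ⟨b, hb⟩ := exists_bound_of_lt_boundingNumber hJ
      fun j k => (Finset.range (k + 1)).sup fun n => h j n (e.symm k)
    obtain ⟨j, hj⟩ := hcov _ (hle (thin_mem_contour (node c) fun l => b (e l)))
    obtain ⟨n, hn⟩ := eventually_atTop.1 (hb j)
    refine hnot j n (mem_of_superset hj (thin_anti _ fun l => ?_))
    rcases lt_or_ge (e l) n with hl | hl
    · rw [hz j n l hl]; exact Nat.zero_le _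
    · refine le_trans ?_ (hn (e l) hl)
      have := Finset.le_sup (f := fun n => h j n (e.symm (e l)))
        (Finset.mem_range.2 (Nat.lt_succ_of_le hl))
      simpa using this
  refine ⟨j, ?_⟩
  let T : ℕ → Set ℕ := fun k => ⋃ m, ⋃ (_ : k ≤ m), (c m).maxSet
  have hT : ∀ k, T k ∈ 𝓕 := fun k => hle <| mem_contour_node.2 <| by
    rw [Nat.cofinite_eq_atTop]
    filter_upwards [eventually_ge_atTop k] with m hm
    exact mem_of_superset (maxSet_mem_contour _) (subset_iUnion₂_of_subset m hm subset_rfl)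
  have hTanti : ∀ {k k'}, k ≤ k' → T k' ⊆ T k := fun hk => iUnion_subset fun m =>
    iUnion_subset fun hm => subset_iUnion₂_of_subset m (hk.trans hm) subset_rfl
  have hgq : ∀ A ∈ 𝓕, g j '' A ∈ q j := fun A hA => by
    have : map (g j) 𝓕 = q j := (q j).unique (hg j)
    rw [← Ultrafilter.mem_coe, ← this]
    exact image_mem_map hA
  -- A section of `g j` on `s j` whose values lie in sets `T k` with `k` as large as possible.
  classical
  let P : ℕ → ℕ → Prop := fun x k => ∃ y ∈ s j ∩ T k, g j y = x
  have hφ : ∀ x, ∃ y, P x 0 → y ∈ s j ∩ T (Nat.findGreatest (P x) x) ∧ g j y = x := fun x => by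
    by_cases h0 : P x 0
    · obtain ⟨y, hy, hyx⟩ := Nat.findGreatest_spec (P := P x) (Nat.zero_le x) h0
      exact ⟨y, fun _ => ⟨hy, hyx⟩⟩
    · exact ⟨0, fun h => absurd h h0⟩
  choose φ hφ using hφ
  refine ⟨φ, fun A hA => ?_⟩
  obtain ⟨h, hh⟩ := exists_thin_subset hA
  obtain ⟨U, hU, hUs⟩ : ∃ U ∈ q j, g j ⁻¹' U ∩ s j ⊆
      (node c).thin fun l => if e l < n then 0 else h l := by
    obtain ⟨U, hU, hUU⟩ := mem_comap.1 (mem_inf_principal.1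
      (hjn (fun l => if e l < n then 0 else h l) fun l hl => if_pos hl))
    exact ⟨U, hU, fun x hx => hUU hx.1 hx.2⟩
  -- Below a successor of the root of index at least `K` no node is among those where `h` was
  -- reset to `0`.
  obtain ⟨K, hK0, hK⟩ : ∃ K, h [] ≤ K ∧ ∀ m, K ≤ m → ∀ l, n ≤ e (m :: l) := by
    have hfin : ({l | e l < n} : Set (List ℕ)).Finite :=
      (Set.finite_lt_nat n).preimage e.injective.injOn
    obtain ⟨M, hM⟩ := (hfin.image List.headI).bddAbove
    refine ⟨max (h []) (M + 1), le_max_left _ _, fun m hm l => ?_⟩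
    by_contra! hlt
    have : m ≤ M := hM ⟨m :: l, hlt, rfl⟩
    have := (le_max_right (h []) (M + 1)).trans hm
    omega
  have hge : {x | K ≤ x} ∈ q j := hq j <| by
    rw [Nat.cofinite_eq_atTop]; exact eventually_ge_atTop K
  have hE : g j '' (s j ∩ T K) ∈ q j := hgq _ (inter_mem (hs j) (hT K))
  refine mem_map.2 (mem_of_superset (inter_mem (inter_mem hU hge) hE) ?_)
  rintro x ⟨⟨hxU, hxK⟩, hxE⟩
  have hPK : P x K := hxE
  have hP0 : P x 0 := by
    obtain ⟨y, hy, hyx⟩ := hPK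
    exact ⟨y, ⟨hy.1, hTanti (Nat.zero_le K) hy.2⟩, hyx⟩
  obtain ⟨⟨hys, hyT⟩, hyx⟩ := hφ x hP0
  have hyK : φ x ∈ T K := hTanti (Nat.le_findGreatest hxK hPK) hyT
  have hyU : φ x ∈ g j ⁻¹' U := by rw [mem_preimage, hyx]; exact hxU
  obtain ⟨m, -, hm⟩ := mem_thin_node.1 (hUs ⟨hyU, hys⟩)
  obtain ⟨m', hm', hmax⟩ := mem_iUnion₂.1 hyK
  obtain rfl : m = m' := by
    by_contra hne
    exact Set.disjoint_left.1 (hinj.2 m m' hne) (thin_subset_maxSet _ _ hm) hmax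
  refine hh (mem_thin_node.2 ⟨m, hK0.trans hm', ?_⟩)
  have heq : (fun l => if e (m :: l) < n then 0 else h (m :: l)) = fun l => h (m :: l) :=
    funext fun l => if_neg (not_lt.2 (hK m hm' l))
  rwa [heq] at hm

/-! ### Transfinite construction of an ultrafilter -/

/-- A filter can be refined to an ultrafilter meeting continuum many requirements as soon as each
requirement can be met by one set on top of fewer than continuum many sets already chosen. -/
theorem exists_ultrafilter_forall_exists_mem {I : Type} (hI : Cardinal.mk I ≤ Cardinal.continuum)
    (G : Filter ℕ) [NeBot G] (R : I → Set (Set ℕ))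
    (hR : ∀ (i : I) (ι : Type) (X : ι → Set ℕ), Cardinal.mk ι < Cardinal.continuum →
      NeBot (G ⊓ ⨅ a, 𝓟 (X a)) → ∃ B ∈ R i, NeBot ((G ⊓ ⨅ a, 𝓟 (X a)) ⊓ 𝓟 B)) :
    ∃ u : Ultrafilter ℕ, (u : Filter ℕ) ≤ G ∧ ∀ i, ∃ B ∈ R i, B ∈ u := by
  classical
  obtain ⟨_, hwo, hr⟩ := Cardinal.exists_ord_eq_type_lt I
  let step : (i : I) → ((i' : I) → i' < i → Set ℕ) → Set ℕ := fun i prev =>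
    if h : ∃ B ∈ R i, NeBot ((G ⊓ ⨅ a : {i' // i' < i}, 𝓟 (prev a.1 a.2)) ⊓ 𝓟 B) then h.choose
    else univ
  let X : I → Set ℕ := wellFounded_lt.fix step
  have hX : ∀ i, X i = step i fun i' _ => X i' := fun i => wellFounded_lt.fix_eq step i
  let F : I → Filter ℕ := fun i => G ⊓ ⨅ a : {i' // i' < i}, 𝓟 (X a.1)
  have hcard : ∀ i, Cardinal.mk {i' // i' < i} < Cardinal.continuum := fun i => by
    exact (Cardinal.card_typein_lt (r := (· < ·)) i hr).trans_le hI
  have hstep : ∀ i, NeBot (F i) → X i ∈ R i ∧ NeBot (F i ⊓ 𝓟 (X i)) := fun i hi => by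
    have h : ∃ B ∈ R i, NeBot ((G ⊓ ⨅ a : {i' // i' < i}, 𝓟 (X a.1)) ⊓ 𝓟 B) :=
      hR i _ _ (hcard i) hi
    have hXi : X i = h.choose := by rw [hX i]; exact dif_pos h
    rw [hXi]
    exact h.choose_spec
  have hanti : ∀ i i', i < i' → F i' ⊓ 𝓟 (X i') ≤ F i ⊓ 𝓟 (X i) := fun i i' h => by
    refine inf_le_left.trans (le_inf (le_inf inf_le_left (le_iInf fun a => ?_)) ?_)
    · exact inf_le_right.trans (iInf_le (fun a : {a // a < i'} => 𝓟 (X a.1))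
        ⟨a.1, a.2.trans h⟩)
    · exact inf_le_right.trans (iInf_le (fun a : {a // a < i'} => 𝓟 (X a.1)) ⟨i, h⟩)
  have hdir : ∀ p : I → Prop, Directed (· ≥ ·) fun a : {i // p i} => F a.1 ⊓ 𝓟 (X a.1) := by
    intro p a a'
    rcases lt_trichotomy a.1 a'.1 with h | h | h
    · exact ⟨a', hanti _ _ h, le_rfl⟩
    · exact ⟨a, le_rfl, by rw [Subtype.ext h]⟩
    · exact ⟨a, le_rfl, hanti _ _ h⟩
  have hlim : ∀ p : I → Prop, (∀ i, p i → NeBot (F i ⊓ 𝓟 (X i))) →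
      NeBot (G ⊓ ⨅ a : {i // p i}, 𝓟 (X a.1)) := by
    intro p hp
    rcases isEmpty_or_nonempty {i // p i} with h | h
    · rw [iInf_of_empty, inf_top_eq]; infer_instance
    · have : NeBot (⨅ a : {i // p i}, F a.1 ⊓ 𝓟 (X a.1)) :=
        iInf_neBot_of_directed (hdir p) fun a => hp a.1 a.2
      refine this.mono (le_inf ?_ (iInf_mono fun a => inf_le_right))
      obtain ⟨a⟩ := h
      exact (iInf_le _ a).trans (inf_le_left.trans inf_le_left)
  have hne : ∀ i, NeBot (F i) := fun i => by
    induction i using WellFoundedLT.induction with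
    | ind i ih => exact hlim (fun i' => i' < i) fun i' hi' => (hstep i' (ih i' hi')).2
  have : NeBot (G ⊓ ⨅ a : {_i : I // True}, 𝓟 (X a.1)) :=
    hlim (fun _ => True) fun i _ => (hstep i (hne i)).2
  refine ⟨Ultrafilter.of (G ⊓ ⨅ a : {_i : I // True}, 𝓟 (X a.1)),
    (Ultrafilter.of_le _).trans inf_le_left, fun i => ⟨X i, (hstep i (hne i)).1, ?_⟩⟩
  exact (Ultrafilter.of_le _).trans (inf_le_right.trans (iInf_le _ ⟨i, trivial⟩))
    (mem_principal_self _)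

/-! ### The inverse limit and its small extensions -/

/-- The inverse limit of a sequence of ultrafilters along connecting maps `f n`, as the infimum of a
decreasing sequence of proper filters. It lives on the coded pairs `(m, x)`: `C i` consists of the
pairs with `i ≤ m`, and `g i` sends such a pair to the image of `x` under `f i ∘ ⋯ ∘ f (m - 1)`. -/
theorem exists_inverse_limit (p : ℕ → Ultrafilter ℕ) (f : ℕ → ℕ → ℕ)
    (hf : ∀ n, (p (n + 1)).map (f n) = p n) :
    ∃ (g : ℕ → ℕ → ℕ) (C : ℕ → Set ℕ),
      Antitone (fun i => comap (g i) (p i) ⊓ 𝓟 (C i)) ∧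
      ∀ i, NeBot (comap (g i) (p i) ⊓ 𝓟 (C i)) := by
  let F : ℕ → ℕ → ℕ → ℕ := fun k => Nat.rec (fun _ x => x) (fun _ ih i x => f i (ih (i + 1) x)) k
  have hF : ∀ k i x, F (k + 1) i x = f i (F k (i + 1) x) := fun _ _ _ => rfl
  let C : ℕ → Set ℕ := fun i => {y | i ≤ y.unpair.1}
  let g : ℕ → ℕ → ℕ := fun i y => F (y.unpair.1 - i) i y.unpair.2
  refine ⟨g, C, antitone_nat_of_succ_le fun i => ?_, fun i => ?_⟩
  · have hg : ∀ y ∈ C (i + 1), g i y = f i (g (i + 1) y) := fun y hy => by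
      have hy' : i + 1 ≤ y.unpair.1 := hy
      have : y.unpair.1 - i = (y.unpair.1 - (i + 1)) + 1 := by omega
      simp only [g]
      rw [this, hF]
    refine le_inf ?_ (inf_le_right.trans (principal_mono.2 fun y hy => (Nat.le_succ i).trans hy))
    rintro A ⟨U, hU, hUA⟩
    refine mem_inf_principal.2 (mem_comap.2 ⟨f i ⁻¹' U, ?_, fun y hy hyC => hUA ?_⟩)
    · rw [← hf i] at hU; exact hU
    · rw [mem_preimage, hg y hyC]; exact hy
  · rw [← forall_mem_nonempty_iff_neBot]
    intro A hA
    obtain ⟨U, hU, hUA⟩ := mem_comap.1 (mem_inf_principal.1 hA)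
    obtain ⟨x, hx⟩ := (p i).nonempty_of_mem hU
    refine ⟨Nat.pair i x, hUA (a := Nat.pair i x) ?_ ?_⟩
    · simpa [g, F] using hx
    · simp [C]

theorem le_cofinite_of_mem_classP {ξ : Ordinal.{0}} (hξ : 1 < ξ) {u : Ultrafilter ℕ}
    (hu : u ∈ classP ξ) : (u : Filter ℕ) ≤ cofinite := by
  obtain ⟨F, ⟨-, V, hV, -, hr, rfl⟩, hle⟩ := hu.1 1 le_rfl hξ
  cases V with
  | leaf x => exact absurd hr zero_ne_one
  | node c => exact hle.trans (contour_le_cofinite hV)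

theorem mk_nat_prod_finset_lt_continuum {ι : Type} (hι : Cardinal.mk ι < Cardinal.continuum) :
    Cardinal.mk (ℕ × Finset ι) < Cardinal.continuum := by
  have hfin : Cardinal.mk (Finset ι) < Cardinal.continuum := by
    rcases finite_or_infinite ι with h | h
    · exact (Cardinal.lt_aleph0_of_finite _).trans Cardinal.aleph0_lt_continuum
    · rwa [Cardinal.mk_finset_of_infinite]
  rw [Cardinal.mk_prod, Cardinal.lift_id, Cardinal.lift_id]
  refine Cardinal.mul_lt_of_lt Cardinal.aleph0_le_continuum ?_ hfin
  rw [Cardinal.mk_nat]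
  exact Cardinal.aleph0_lt_continuum

/-- A proper filter generated by the inverse limit of ultrafilters in `𝒫_ξ` and fewer than `𝔠`
further sets contains no monotone sequential contour of rank `ξ`. -/
theorem not_le_contour (hbc : boundingNumber = Cardinal.continuum) {ξ : Ordinal.{0}} (hξ : 1 < ξ)
    {p : ℕ → Ultrafilter ℕ} (hp : ∀ n, p n ∈ classP ξ) {g : ℕ → ℕ → ℕ} {C : ℕ → Set ℕ}
    (hanti : Antitone fun i => comap (g i) (p i) ⊓ 𝓟 (C i)) {ι : Type}
    (hι : Cardinal.mk ι < Cardinal.continuum) (X : ι → Set ℕ)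
    (hne : NeBot ((⨅ i, comap (g i) (p i) ⊓ 𝓟 (C i)) ⊓ ⨅ a, 𝓟 (X a))) {F : Filter ℕ}
    (hF : IsMonotoneSequentialContour ξ F) :
    ¬ (⨅ i, comap (g i) (p i) ⊓ 𝓟 (C i)) ⊓ ⨅ a, 𝓟 (X a) ≤ F := by
  intro hle
  have hFξ := hF
  obtain ⟨hβ, V, hV, hm, hr, rfl⟩ := hF
  obtain ⟨c, rfl⟩ : ∃ c, V = node c := by
    cases V with
    | leaf x => exact absurd (hr ▸ hβ) (not_le.2 zero_lt_one)
    | node c => exact ⟨c, rfl⟩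
  obtain ⟨j, φ, hφ⟩ := exists_map_le_contour (J := ℕ × Finset ι)
    (hbc ▸ mk_nat_prod_finset_lt_continuum hι) (fun j => p j.1)
    (fun j => le_cofinite_of_mem_classP hξ (hp j.1)) (fun j => g j.1)
    (fun j => map_le_iff_le_comap.2
      (inf_le_left.trans ((iInf_le _ j.1).trans inf_le_left)))
    (fun j => C j.1 ∩ ⋂ a ∈ j.2, X a)
    (fun j => inter_mem
      (mem_inf_of_left (mem_iInf_of_mem j.1 (mem_inf_of_right (mem_principal_self _))))
      ((biInter_finset_mem j.2).2 fun a _ =>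
        mem_inf_of_right (mem_iInf_of_mem a (mem_principal_self _))))
    (fun A hA => by
      obtain ⟨U, hU, W, hW, rfl⟩ := mem_inf_iff.1 hA
      obtain ⟨i, hi⟩ := (mem_iInf_of_directed hanti.directed_ge U).1 hU
      obtain ⟨t, ht⟩ := (mem_iInf_finite W).1 hW
      rw [iInf_principal_finset, mem_principal] at ht
      refine ⟨(i, t), ?_⟩
      rw [← inf_principal, ← inf_assoc]
      exact inter_mem (mem_inf_of_left hi) (mem_inf_of_right (mem_principal.2 ht)))
    hV hle
  exact (hp j.1).2 (exists_contour_of_map_le hFξ hφ)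

end PHierarchy

/-! ### Upper bounds in the Rudin–Keisler order -/

open PHierarchy in
theorem theorem2p21
    (hbc : boundingNumber = Cardinal.continuum)
    (ξ : Ordinal.{0}) (hξ1 : 1 < ξ) (hξ2 : ξ ≤ Ordinal.omega 1)
    (p : ℕ → Ultrafilter ℕ) (hp : ∀ n, p n ∈ classP ξ)
    (hinc : ∀ n, RKLT (p n) (p (n + 1))) :
    ∃ u : Ultrafilter ℕ, u ∈ classP ξ ∧ ∀ n, RKLT (p n) u := by
  choose f hf using fun n => (hinc n).1
  obtain ⟨g, C, hanti, hne⟩ := exists_inverse_limit p f hf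
  have : Filter.NeBot (⨅ i, Filter.comap (g i) (p i) ⊓ Filter.principal (C i)) :=
    Filter.iInf_neBot_of_directed hanti.directed_ge hne
  obtain ⟨u, huG, hu⟩ := exists_ultrafilter_forall_exists_mem
    (I := {V : Cascade // IsMonotoneSequentialContour ξ V.contour})
    ((Cardinal.mk_subtype_le _).trans Cascade.mk_le_continuum)
    (⨅ i, Filter.comap (g i) (p i) ⊓ Filter.principal (C i))
    (fun V => {B | Bᶜ ∈ V.1.contour}) (by
      intro V ι X hι hX
      obtain ⟨A, hA, hAn⟩ := Filter.not_le.1 (not_le_contour hbc hξ1 hp hanti hι X hX V.2)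
      refine ⟨Aᶜ, by simpa using hA, ?_⟩
      rw [Filter.neBot_iff, Ne, Filter.inf_principal_eq_bot, compl_compl]
      exact hAn)
  have hmap : ∀ n, u.map (g n) = p n := fun n => by
    refine Ultrafilter.coe_le_coe.1 ?_
    exact Filter.map_le_iff_le_comap.2 (huG.trans ((iInf_le _ n).trans inf_le_left))
  refine ⟨u, ⟨fun β hβ hβξ => ?_, ?_⟩, fun n => ⟨⟨g n, hmap n⟩, ?_⟩⟩
  · obtain ⟨F, hF, hle⟩ := (hp 0).1 β hβ hβξ
    refine exists_contour_of_map_le (f := g 0) hF ?_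
    rw [← Ultrafilter.coe_map, hmap 0]
    exact hle
  · rintro ⟨F, hF, hle⟩
    have hF' := hF
    obtain ⟨-, V, -, -, -, rfl⟩ := hF'
    obtain ⟨B, hB, hBu⟩ := hu ⟨V, hF⟩
    exact Ultrafilter.compl_mem_iff_notMem.1 (hle hB) hBu
  · -- Otherwise `p (n + 1) ≤ u ≤ p n` in the Rudin–Keisler order.
    rintro ⟨k, hk⟩
    refine (hinc n).2 ⟨g (n + 1) ∘ k, ?_⟩
    rw [← Ultrafilter.map_map, hk, hmap]
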